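/- Let $G=(V,E)$ be a finite simple planar graph on $n$ vertices, and let $L$ be a list assignment for $G$, i.e. a function assigning to each vertex $v\in V$ a set $L(v)$ of colours, with $|L(v)|\ge 11$ for every $v\in V$. An $L$-colouring of $G$ is a proper colouring $\varphi$ of $G$ with $\varphi(v)\in L(v)$ for all $v\in V$, and the $L$-recolouring graph $\mathcal{G}(G,L)$ is the graph whose vertices are the $L$-colourings of $G$, two of them being adjacent if and only if they differ on exactly one vertex of $G$. Then $\mathcal{G}(G,L)$ has diameter $O(n)$; more precisely, its diameter is at most $100n$, and for any two $L$-colourings $\alpha,\beta$ of $G$ there is a path of single-vertex recolourings (a walk in $\mathcal{G}(G,L)$) from $\alpha$ to $\beta$ along which every vertex of $G$ changes its colour at most $100$ times. -/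

import Mathlib

namespace Recolouring

/-- A rotation system (combinatorial embedding) of a graph `G`: a permutation `next` of the darts
(oriented edges) of `G` whose cycles are exactly the sets of darts leaving a common vertex. It
records the cyclic order of the edges around every vertex of a drawing of `G` on an oriented
surface. -/
structure RotationSystem {V : Type*} (G : SimpleGraph V) where
  /-- The dart that follows a given dart in the cyclic order around its initial vertex. -/
  next : Equiv.Perm G.Dart
  fst_next : ∀ d : G.Dart, (next d).fst = d.fst
  sameCycle_of_fst_eq : ∀ d d' : G.Dart, d.fst = d'.fst → next.SameCycle d d'

namespace RotationSystem

variable {V : Type*} {G : SimpleGraph V}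

/-- The face permutation: traverse the dart `d`, then leave its terminal vertex along the dart
that follows the reversal of `d` in the rotation. Its cycles are the facial walks. -/
def facePerm (R : RotationSystem G) : Equiv.Perm G.Dart :=
  (SimpleGraph.Dart.symm_involutive (G := G)).toPerm.trans R.next

/-- The facial walks of positive length: the cycles of the face permutation. -/
abbrev FacialWalk (R : RotationSystem G) : Type _ :=
  Quotient (Equiv.Perm.SameCycle.setoid R.facePerm)

/-- The faces, each connected component being drawn on a surface of its own. A component that is
an isolated vertex has no darts, and the single face around that vertex is counted separately. -/
abbrev Face (R : RotationSystem G) : Type _ :=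
  R.FacialWalk ⊕ {v : V // ∀ w, ¬ G.Adj v w}

/-- The rotation system has genus zero: every connected component is drawn on a sphere. Each
component has Euler characteristic `|V| - |E| + |F| ≤ 2`, with equality exactly on the sphere, so
that it suffices to ask `|V| - |E| + |F| = 2 c` in total, where `c` is the number of components. -/
def IsSpherical (R : RotationSystem G) : Prop :=
  Nat.card V + Nat.card R.Face = Nat.card G.edgeSet + 2 * Nat.card G.ConnectedComponent

end RotationSystem

/-- A finite graph is planar if it has a combinatorial embedding of genus zero. -/
def IsPlanar {V : Type*} [Finite V] (G : SimpleGraph V) : Prop :=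
  ∃ R : RotationSystem G, R.IsSpherical

/-- The `L`-colourings of `G`: the proper colourings `c` of `G` with `c v ∈ L v` for all `v`. -/
abbrev ListColouring {V α : Type*} (G : SimpleGraph V) (L : V → Set α) : Type _ :=
  {c : G.Coloring α // ∀ v, c v ∈ L v}

/-- The `L`-recolouring graph of `G`: its vertices are the `L`-colourings of `G`, two of them being
adjacent if they differ on exactly one vertex of `G`. -/
def recolouringGraph {V α : Type*} (G : SimpleGraph V) (L : V → Set α) :
    SimpleGraph (ListColouring G L) where
  Adj c c' := ∃! v, c.1 v ≠ c'.1 v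
  symm := ⟨fun c c' h => by simpa only [ne_comm] using h⟩
  loopless := ⟨fun c h => by obtain ⟨v, hv, _⟩ := h; exact hv rfl⟩

open Classical in
/-- The number of steps of the recolouring sequence `w` that change the colour of `v`. -/
noncomputable def timesRecoloured {V α : Type*} {G : SimpleGraph V} {L : V → Set α}
    {c c' : ListColouring G L} (w : (recolouringGraph G L).Walk c c') (v : V) : ℕ :=
  w.darts.countP (fun d => d.fst.1 v ≠ d.snd.1 v)

end Recolouring

/-! Extension: if `v` has at most `d` neighbours in `S` and at least `d + s + 1` colours, a
recolouring of `S` extends to `v`. When a neighbour is about to take the colour of `v`, move `v` to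
a colour absent from its neighbours and from their next `s` moves. With `t` moves among the
neighbours, `v` moves at most `⌈t / s⌉` times, plus once to reach its target
(`RecolourableWithin.insert_vertex`). With 11 colours and all counts at most 100, four neighbours
give `⌈400 / 6⌉ + 1 = 68` moves; five, one of which moves at most 68 times, give `⌈468 / 5⌉ + 1 =
95`. The bound 100 is therefore preserved when `v` goes back with at most four neighbours, followed
by vertices that have at most five neighbours including `v`.

Structure (`IsPlanarMapOn.exists_reducible`): discharging shows that every nonempty induced subgraph
of a planar graph has a vertex with at most four neighbours of degree other than 5, or a triangle of
degrees 5, 6, 6. Both can be removed and restored in the above manner, so induction on the vertex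
set finishes (`recolourableWithin_hundred`).

Euler's inequality is needed for induced subgraphs. A map is a pair of permutations of the darts,
and deleting a dart is multiplication by a transposition, which preserves planarity
(`IsPlanarPair.swap_mul`). -/

/-! ### Merging two classes of an equivalence relation. -/

namespace Setoid

variable {D : Type*}

open Classical in
/-- The equivalence relation obtained from `r` by merging the classes of `a` and `b`. -/
noncomputable def merge (r : Setoid D) (a b : D) : Setoid D :=
  Setoid.ker fun x => if r x b then (Quotient.mk r a) else Quotient.mk r x

open Classical in
theorem le_merge (r : Setoid D) (a b : D) : r ≤ r.merge a b := by
  intro x y h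
  have hb : r x b ↔ r y b := ⟨fun k => r.trans (r.symm h) k, fun k => r.trans h k⟩
  change (if r x b then _ else _) = (if r y b then _ else _)
  simp only [hb]
  split_ifs
  · rfl
  · exact Quotient.sound h

open Classical in
theorem merge_rel (r : Setoid D) (a b : D) : r.merge a b a b := by
  change (if r a b then _ else _) = (if r b b then _ else _)
  simp

open Classical in
theorem merge_le {r s : Setoid D} {a b : D} (h : r ≤ s) (hab : s a b) : r.merge a b ≤ s := by
  intro x y hxy
  change (if r x b then _ else _) = (if r y b then _ else _) at hxy
  split_ifs at hxy with h1 h2 h2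
  · exact s.trans (h h1) (s.symm (h h2))
  · exact s.trans (h h1) (s.trans (s.symm hab) (h (Quotient.exact hxy)))
  · exact s.trans (h (Quotient.exact hxy)) (s.trans hab (s.symm (h h2)))
  · exact h (Quotient.exact hxy)

theorem merge_eq_self {r : Setoid D} {a b : D} (h : r a b) : r.merge a b = r :=
  le_antisymm (merge_le le_rfl h) (r.le_merge a b)

variable [Finite D]

theorem card_quotient_le {r s : Setoid D} (h : r ≤ s) :
    Nat.card (Quotient s) ≤ Nat.card (Quotient r) :=
  Nat.card_le_card_of_surjective (Quotient.map' id h) fun q => by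
    induction q using Quotient.inductionOn with
    | h x => exact ⟨Quotient.mk r x, rfl⟩

theorem card_quotient_merge {r : Setoid D} {a b : D} (h : ¬ r a b) :
    Nat.card (Quotient (r.merge a b)) + 1 = Nat.card (Quotient r) := by
  classical
  have hr : Set.range (fun x => if r x b then (Quotient.mk r a) else Quotient.mk r x)
      = {Quotient.mk r b}ᶜ := by
    ext q
    induction q using Quotient.inductionOn with
    | h y =>
      simp only [Set.mem_range, Set.mem_compl_iff, Set.mem_singleton_iff]
      constructor
      · rintro ⟨x, hx⟩ hy
        rw [hy] at hx
        split_ifs at hx with h1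
        · exact h (Quotient.exact hx)
        · exact h1 (Quotient.exact hx)
      · intro hy
        refine ⟨y, ?_⟩
        rw [if_neg fun k => hy (Quotient.sound k)]
  have h1 := Nat.card_congr (Setoid.quotientKerEquivRange
    (fun x => if r x b then (Quotient.mk r a) else Quotient.mk r x))
  rw [hr] at h1
  have h2 := Set.ncard_add_ncard_compl {Quotient.mk r b}
  rw [Set.ncard_singleton] at h2
  change Nat.card (Quotient (Setoid.ker _)) + 1 = _
  rw [h1, ← h2, add_comm]
  rfl

theorem card_quotient_le_merge (r : Setoid D) (a b : D) :
    Nat.card (Quotient r) ≤ Nat.card (Quotient (r.merge a b)) + 1 := by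
  by_cases h : r a b
  · rw [merge_eq_self h]; omega
  · rw [card_quotient_merge h]

end Setoid

/-! ### Cycle counts and planar pairs of permutations. -/

namespace Equiv.Perm

variable {D : Type*}

/-- The number of cycles of a permutation, fixed points included. -/
noncomputable def cycleCount (σ : Perm D) : ℕ := Nat.card (Quotient (SameCycle.setoid σ))

theorem cycleCount_mul_comm (σ τ : Perm D) : cycleCount (σ * τ) = cycleCount (τ * σ) := by
  refine Nat.card_congr (Quotient.congr τ fun x y => ?_)
  change SameCycle (σ * τ) x y ↔ SameCycle (τ * σ) (τ x) (τ y)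
  have : τ * σ = τ * (σ * τ) * τ⁻¹ := by group
  rw [this, sameCycle_conj]
  simp

/-- The Euler inequality stating that two permutations, taken as the vertex and the edge
permutation of a combinatorial map, describe a disjoint union of spheres. -/
def IsPlanarPair (σ τ : Perm D) : Prop :=
  Nat.card D + 2 * Nat.card (Quotient (SameCycle.setoid σ ⊔ SameCycle.setoid τ)) ≤
    cycleCount σ + cycleCount τ + cycleCount (σ * τ)

theorem IsPlanarPair.symm {σ τ : Perm D} (h : IsPlanarPair σ τ) : IsPlanarPair τ σ := by
  unfold IsPlanarPair at *
  rw [sup_comm, cycleCount_mul_comm]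
  omega

variable [Finite D]

theorem sameCycleSetoid_le_iff {σ : Perm D} {s : Setoid D} :
    SameCycle.setoid σ ≤ s ↔ ∀ x, s x (σ x) := by
  constructor
  · intro h x
    exact h (sameCycle_apply_right.2 SameCycle.rfl : SameCycle σ x (σ x))
  · intro h x y hxy
    obtain ⟨n, rfl⟩ := SameCycle.exists_nat_pow_eq (f := σ) hxy
    clear hxy
    induction n with
    | zero => exact s.refl x
    | succ n ih => rw [pow_succ', mul_apply]; exact s.trans ih (h _)

theorem sameCycleSetoid_mul_le (σ τ : Perm D) :
    SameCycle.setoid (σ * τ) ≤ SameCycle.setoid σ ⊔ SameCycle.setoid τ := by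
  rw [sameCycleSetoid_le_iff]
  intro x
  have h1 := (sameCycleSetoid_le_iff.1 (le_sup_left :
    SameCycle.setoid σ ≤ SameCycle.setoid σ ⊔ SameCycle.setoid τ)) (τ x)
  have h2 := (sameCycleSetoid_le_iff.1 (le_sup_right :
    SameCycle.setoid τ ≤ SameCycle.setoid σ ⊔ SameCycle.setoid τ)) x
  exact Setoid.trans' _ h2 h1

variable [DecidableEq D]

theorem sameCycleSetoid_swap_mul_le {σ : Perm D} {s : Setoid D} {a b : D}
    (h : SameCycle.setoid σ ≤ s) (hab : s a b) : SameCycle.setoid (swap a b * σ) ≤ s := by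
  rw [sameCycleSetoid_le_iff] at h ⊢
  intro x
  rw [mul_apply]
  rcases eq_or_ne (σ x) a with h1 | h1
  · have := h x
    rw [h1] at this ⊢
    rw [swap_apply_left]
    exact s.trans this hab
  · rcases eq_or_ne (σ x) b with h2 | h2
    · have := h x
      rw [h2] at this ⊢
      rw [swap_apply_right]
      exact s.trans this (s.symm hab)
    · rw [swap_apply_of_ne_of_ne h1 h2]
      exact h x

/-- Multiplying by `swap a b` affects only the cycles through `a` and `b`, so the difference
disappears once these are merged. All comparisons of cycle counts below rest on this. -/
theorem merge_swap_mul (σ : Perm D) (a b : D) :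
    (SameCycle.setoid (swap a b * σ)).merge a b = (SameCycle.setoid σ).merge a b := by
  apply le_antisymm
  · exact Setoid.merge_le (sameCycleSetoid_swap_mul_le (Setoid.le_merge _ _ _)
      (Setoid.merge_rel _ _ _)) (Setoid.merge_rel _ _ _)
  · refine Setoid.merge_le ?_ (Setoid.merge_rel _ _ _)
    have := sameCycleSetoid_swap_mul_le (Setoid.le_merge (SameCycle.setoid (swap a b * σ)) a b)
      (Setoid.merge_rel _ _ _)
    rwa [swap_mul_self_mul] at this

theorem sameCycle_swap_mul {σ : Perm D} {a b : D} (h : ¬ SameCycle σ a b) :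
    SameCycle (swap a b * σ) a b := by
  by_contra hc
  -- The `σ`-orbit of `a` avoids `b`, so the new permutation follows it as far as `σ⁻¹ a`, which it
  -- sends to `b`.
  have key : ∀ n : ℕ, SameCycle (swap a b * σ) a ((σ ^ n) a) := by
    intro n
    induction n with
    | zero => exact SameCycle.rfl
    | succ n ih =>
      rw [pow_succ', mul_apply]
      have h2 : σ ((σ ^ n) a) ≠ b := by
        intro hb
        exact h ⟨(n + 1 : ℕ), by rw [zpow_natCast, pow_succ', mul_apply, hb]⟩
      rcases eq_or_ne (σ ((σ ^ n) a)) a with h1 | h1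
      · rw [h1]
      · have : (swap a b * σ) ((σ ^ n) a) = σ ((σ ^ n) a) := by
          rw [mul_apply, swap_apply_of_ne_of_ne h1 h2]
        rw [← this]
        exact sameCycle_apply_right.2 ih
  have h3 : SameCycle σ a (σ⁻¹ a) := ⟨-1, by simp⟩
  obtain ⟨n, hn⟩ := h3.exists_nat_pow_eq
  have h4 := key n
  rw [hn] at h4
  have h5 := sameCycle_apply_right.2 h4
  rw [mul_apply, show σ (σ⁻¹ a) = a by simp, swap_apply_left] at h5
  exact hc h5

/-- Splitting a cycle preserves planarity. -/
theorem IsPlanarPair.swap_mul {σ τ : Perm D} {a b : D} (h : IsPlanarPair σ τ)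
    (hab : SameCycle σ a b) (hab' : ¬ SameCycle (swap a b * σ) a b) :
    IsPlanarPair (swap a b * σ) τ := by
  unfold IsPlanarPair at *
  have h1 : cycleCount (swap a b * σ) = cycleCount σ + 1 := by
    have e1 := Setoid.card_quotient_merge (r := SameCycle.setoid (swap a b * σ)) hab'
    rw [merge_swap_mul, Setoid.merge_eq_self (r := SameCycle.setoid σ) hab] at e1
    exact e1.symm
  have h2 : (SameCycle.setoid (swap a b * σ) ⊔ SameCycle.setoid τ).merge a b
      = SameCycle.setoid σ ⊔ SameCycle.setoid τ := by
    apply le_antisymm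
    · have e : (SameCycle.setoid σ ⊔ SameCycle.setoid τ) a b :=
        (le_sup_left : SameCycle.setoid σ ≤ _) hab
      exact Setoid.merge_le (sup_le (sameCycleSetoid_swap_mul_le le_sup_left e) le_sup_right) e
    · refine sup_le ?_ (le_trans le_sup_right (Setoid.le_merge _ _ _))
      have := sameCycleSetoid_swap_mul_le
        (le_trans le_sup_left (Setoid.le_merge
          (SameCycle.setoid (swap a b * σ) ⊔ SameCycle.setoid τ) a b))
        (Setoid.merge_rel _ _ _)
      rwa [swap_mul_self_mul] at this
  have h3 := merge_swap_mul (σ * τ) a b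
  rw [h1, mul_assoc]
  -- If `a` and `b` stay in one orbit, the orbits are unchanged, and the cycle gained by `σ` pays
  -- for the at most one lost by `σ * τ`.
  by_cases hR : (SameCycle.setoid (swap a b * σ) ⊔ SameCycle.setoid τ) a b
  · rw [Setoid.merge_eq_self hR] at h2
    rw [h2]
    have h4 := Setoid.card_quotient_le
      (Setoid.le_merge (SameCycle.setoid (swap a b * (σ * τ))) a b)
    rw [h3] at h4
    have h5 := Setoid.card_quotient_le_merge (SameCycle.setoid (σ * τ)) a b
    unfold cycleCount at *
    omega
  -- Otherwise there is one more orbit, costing 2. The cycles of the new product lie within orbits,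
  -- so they separate `a` from `b`; hence `σ * τ` gains a cycle too.
  · have h4 := Setoid.card_quotient_merge hR
    rw [h2] at h4
    have h5 : ¬ SameCycle (swap a b * (σ * τ)) a b := fun k =>
      hR (sameCycleSetoid_mul_le (swap a b * σ) τ (by rw [mul_assoc]; exact k))
    have h6 : SameCycle (σ * τ) a b := by
      by_contra k
      exact h5 (sameCycle_swap_mul k)
    have h7 := Setoid.card_quotient_merge (r := SameCycle.setoid (swap a b * (σ * τ))) h5
    rw [h3, Setoid.merge_eq_self (r := SameCycle.setoid (σ * τ)) h6] at h7
    unfold cycleCount at *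
    omega

/-- Making a point a fixed point of one of the permutations preserves planarity. -/
theorem IsPlanarPair.swap_apply_mul {σ τ : Perm D} (h : IsPlanarPair σ τ) (a : D) :
    IsPlanarPair (swap a (σ a) * σ) τ := by
  rcases eq_or_ne (σ a) a with ha | ha
  · rw [ha, swap_self]
    exact h
  · refine h.swap_mul (sameCycle_apply_right.2 SameCycle.rfl) fun k => ?_
    have : Function.IsFixedPt (swap a (σ a) * σ) a := by
      rw [Function.IsFixedPt, mul_apply, swap_apply_right]
    exact ha (k.eq_of_left this).symm

theorem sameCycle_swap_apply_mul {σ : Perm D} {a x y : D} (h : SameCycle σ x y) (hx : x ≠ a)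
    (hy : y ≠ a) : SameCycle (swap a (σ a) * σ) x y := by
  obtain ⟨n, rfl⟩ := h.exists_nat_pow_eq
  clear h
  -- The new permutation bypasses `a`: while the `σ`-walk stands at `a`, it is already at `σ a`.
  suffices H : ∀ n : ℕ, ((σ ^ n) x = a ∧ SameCycle (swap a (σ a) * σ) x (σ a)) ∨
      SameCycle (swap a (σ a) * σ) x ((σ ^ n) x) from
    (H n).resolve_left fun k => hy k.1
  clear hy
  intro n
  induction n with
  | zero => exact Or.inr SameCycle.rfl
  | succ n ih =>
    rw [pow_succ', mul_apply]
    rcases ih with ⟨h1, h2⟩ | ih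
    · rw [h1]
      exact Or.inr h2
    · have h3 := sameCycle_apply_right.2 ih
      rw [mul_apply] at h3
      rcases eq_or_ne (σ ((σ ^ n) x)) a with h1 | h1
      · rw [h1, swap_apply_left] at h3
        exact Or.inl ⟨h1, h3⟩
      · rcases eq_or_ne ((σ ^ n) x) a with h2 | h2
        · rw [h2, swap_apply_right] at h3
          rw [h2] at ih
          have hf : Function.IsFixedPt (swap a (σ a) * σ) a := by
            rw [Function.IsFixedPt, mul_apply, swap_apply_right]
          exact absurd (ih.eq_of_right hf) hx
        · rw [swap_apply_of_ne_of_ne h1 fun k => h2 (σ.injective k)] at h3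
          exact Or.inr h3

end Equiv.Perm

/-! ### Deleting edges from a planar map. -/

namespace SimpleGraph

open Equiv Equiv.Perm

variable {V : Type*} {G : SimpleGraph V}

instance Dart.finite [Finite V] : Finite G.Dart :=
  Finite.of_injective (fun d : G.Dart => d.toProd) fun _ _ h => Dart.ext _ _ h

/-- `σ` and `τ` are the vertex and the edge permutation of a spherical embedding of the subgraph
of `G` with set of darts `T`; both fix all the other darts. -/
structure IsPlanarMapOn (σ τ : Perm G.Dart) (T : Set G.Dart) : Prop where
  symm_mem : ∀ d ∈ T, d.symm ∈ T
  fst_apply : ∀ d, (σ d).fst = d.fst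
  apply_of_notMem : ∀ d ∉ T, σ d = d
  sameCycle : ∀ d ∈ T, ∀ d' ∈ T, d.fst = d'.fst → SameCycle σ d d'
  edge_apply : ∀ d ∈ T, τ d = d.symm
  edge_apply_of_notMem : ∀ d ∉ T, τ d = d
  planar : IsPlanarPair σ τ

namespace IsPlanarMapOn

variable {σ τ : Perm G.Dart} {T : Set G.Dart}

theorem apply_mem (h : IsPlanarMapOn σ τ T) {d : G.Dart} (hd : d ∈ T) : σ d ∈ T := by
  by_contra k
  have := h.apply_of_notMem _ k
  rw [σ.injective this] at k
  exact k hd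

variable [Finite V]

theorem exists_delete (h : IsPlanarMapOn σ τ T) {d : G.Dart} (hd : d ∈ T) :
    ∃ σ' τ' : Perm G.Dart, IsPlanarMapOn σ' τ' (T \ {d, d.symm}) := by
  classical
  have fst_swap : ∀ (ρ : Perm G.Dart), (∀ x, (ρ x).fst = x.fst) → ∀ a x,
      ((swap a (ρ a) * ρ) x).fst = x.fst := by
    intro ρ hρ a x
    rw [mul_apply]
    rcases eq_or_ne (ρ x) a with h1 | h1
    · rw [h1, swap_apply_left, hρ, ← h1, hρ]
    · rcases eq_or_ne (ρ x) (ρ a) with h2 | h2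
      · rw [h2, swap_apply_right, ← hρ, ← h2, hρ]
      · rw [swap_apply_of_ne_of_ne h1 h2, hρ]
  have fix : ∀ (ρ : Perm G.Dart) (a x : G.Dart), ρ x = x → (swap a (ρ a) * ρ) x = x := by
    intro ρ a x hx
    rw [mul_apply, hx]
    rcases eq_or_ne x a with rfl | h1
    · rw [hx, swap_self]; rfl
    · rw [swap_apply_of_ne_of_ne h1]
      rintro rfl
      exact h1 (ρ.injective hx)
  have fix' : ∀ (ρ : Perm G.Dart) (a : G.Dart), (swap a (ρ a) * ρ) a = a := by
    intro ρ a
    rw [mul_apply, swap_apply_right]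
  -- Both darts must be cut out of `σ`, whereas one transposition suffices for `τ`, in which they
  -- form a 2-cycle. The deleted darts remain as common fixed points; each satisfies the Euler
  -- inequality with equality, as `1 + 2 = 1 + 1 + 1`.
  refine ⟨swap d.symm ((swap d (σ d) * σ) d.symm) * (swap d (σ d) * σ), swap d (τ d) * τ,
    ⟨?_, ?_, ?_, ?_, ?_, ?_, ?_⟩⟩
  · rintro x ⟨hx, hxd⟩
    refine ⟨h.symm_mem x hx, fun k => hxd ?_⟩
    rcases k with k | k
    · right
      rw [Set.mem_singleton_iff, ← k, Dart.symm_symm]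
    · left
      rw [Set.mem_singleton_iff] at k
      rw [← Dart.symm_symm x, k, Dart.symm_symm]
  · exact fst_swap _ (fst_swap _ h.fst_apply _) _
  · intro x hx
    by_cases h1 : x = d.symm
    · rw [h1, fix']
    · apply fix
      by_cases h2 : x = d
      · rw [h2, fix']
      · apply fix
        exact h.apply_of_notMem x fun k => hx ⟨k, fun k => k.elim h2 h1⟩
  · rintro x ⟨hx, hxd⟩ y ⟨hy, hyd⟩ hxy
    simp only [Set.mem_insert_iff, Set.mem_singleton_iff, not_or] at hxd hyd
    exact sameCycle_swap_apply_mul (sameCycle_swap_apply_mul (h.sameCycle x hx y hy hxy)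
      hxd.1 hyd.1) hxd.2 hyd.2
  · rintro x ⟨hx, hxd⟩
    simp only [Set.mem_insert_iff, Set.mem_singleton_iff, not_or] at hxd
    rw [mul_apply, h.edge_apply x hx, h.edge_apply d hd, swap_apply_of_ne_of_ne]
    · intro k
      exact hxd.2 (by rw [← k, Dart.symm_symm])
    · intro k
      exact hxd.1 (Dart.symm_involutive.injective k)
  · intro x hx
    by_cases h1 : x = d.symm
    · rw [h1, mul_apply, h.edge_apply _ (h.symm_mem d hd), h.edge_apply d hd, Dart.symm_symm,
        swap_apply_left]
    · by_cases h2 : x = d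
      · rw [h2, fix']
      · exact fix _ _ _ (h.edge_apply_of_notMem x fun k => hx ⟨k, fun k => k.elim h2 h1⟩)
  · exact ((h.planar.swap_apply_mul d).swap_apply_mul d.symm).symm.swap_apply_mul d |>.symm

theorem exists_delete_finset (h : IsPlanarMapOn σ τ Set.univ) (R : Finset G.Dart) :
    ∃ σ' τ' : Perm G.Dart, IsPlanarMapOn σ' τ' {d | d ∉ R ∧ d.symm ∉ R} := by
  classical
  induction R using Finset.induction_on with
  | empty =>
    refine ⟨σ, τ, ?_⟩
    convert h
    simp
  | insert a R _ ih =>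
    obtain ⟨σ', τ', h'⟩ := ih
    have hset : {d | d ∉ insert a R ∧ d.symm ∉ insert a R} =
        {d | d ∉ R ∧ d.symm ∉ R} \ {a, a.symm} := by
      ext d
      have : d = a.symm ↔ d.symm = a :=
        ⟨fun k => by rw [k, Dart.symm_symm], fun k => by rw [← k, Dart.symm_symm]⟩
      simp only [Finset.mem_insert, not_or, Set.mem_ofPred_eq, Set.mem_sdiff, Set.mem_insert_iff,
        Set.mem_singleton_iff, this]
      tauto
    rw [hset]
    by_cases ha : a ∈ {d : G.Dart | d ∉ R ∧ d.symm ∉ R}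
    · exact h'.exists_delete ha
    · refine ⟨σ', τ', ?_⟩
      rwa [sdiff_eq_left.2]
      rw [Set.disjoint_right]
      rintro x (rfl | rfl) hx
      · exact ha hx
      · exact ha ⟨by simpa using hx.2, hx.1⟩

theorem exists_induce (h : IsPlanarMapOn σ τ Set.univ) (S : Set V) :
    ∃ σ' τ' : Perm G.Dart, IsPlanarMapOn σ' τ' {d | d.fst ∈ S ∧ d.snd ∈ S} := by
  classical
  obtain ⟨σ', τ', h'⟩ := h.exists_delete_finset
    (Set.toFinite {d : G.Dart | ¬ (d.fst ∈ S ∧ d.snd ∈ S)}).toFinset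
  refine ⟨σ', τ', ?_⟩
  convert h' using 1
  ext d
  simp [and_comm]

end IsPlanarMapOn

end SimpleGraph

/-! ### From spherical rotation systems to planar pairs. -/

namespace Recolouring.RotationSystem

open Equiv Equiv.Perm SimpleGraph

variable {V : Type*} [Finite V] {G : SimpleGraph V}

/-- The permutation of the darts that reverses every dart. -/
abbrev symmPerm (G : SimpleGraph V) : Perm G.Dart :=
  (SimpleGraph.Dart.symm_involutive (G := G)).toPerm

/-- This and the next two bounds turn vertices, edges and components into cycles and orbits of
darts. Isolated vertices have no darts and are counted apart. -/
theorem card_le_cycleCount_next_add (R : RotationSystem G) :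
    Nat.card V ≤ cycleCount R.next + Nat.card {v : V // ∀ w, ¬ G.Adj v w} := by
  classical
  rw [cycleCount, ← Nat.card_sum]
  have key : ∀ v : V, (¬ ∀ w, ¬ G.Adj v w) → ∃ d : G.Dart, d.fst = v := by
    intro v hv
    push Not at hv
    obtain ⟨w, hw⟩ := hv
    exact ⟨⟨(v, w), hw⟩, rfl⟩
  choose f hf using key
  refine Nat.card_le_card_of_injective (fun v => if h : ∀ w, ¬ G.Adj v w then Sum.inr ⟨v, h⟩
    else Sum.inl (Quotient.mk _ (f v h))) fun v v' hvv => ?_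
  dsimp only at hvv
  split_ifs at hvv with h1 h2 h2
  · simpa using hvv
  · have h3 : SameCycle R.next (f v h1) (f v' h2) := Quotient.exact (Sum.inl.inj hvv)
    have h4 : SameCycle.setoid R.next ≤ Setoid.ker fun d => d.fst :=
      sameCycleSetoid_le_iff.2 fun x => (R.fst_next x).symm
    have h5 : (f v h1).fst = (f v' h2).fst := h4 h3
    rwa [hf, hf] at h5

theorem card_edgeSet_le_cycleCount_symm (G : SimpleGraph V) :
    Nat.card G.edgeSet ≤ cycleCount (symmPerm G) := by
  have key : ∀ e : G.edgeSet, ∃ d : G.Dart, d.edge = e := by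
    rintro ⟨e, he⟩
    induction e using Sym2.ind with
    | h v w => exact ⟨⟨(v, w), he⟩, rfl⟩
  choose f hf using key
  refine Nat.card_le_card_of_injective (fun e => Quotient.mk _ (f e)) fun e e' h => ?_
  have h3 : SameCycle (symmPerm G) (f e) (f e') := Quotient.exact h
  have h4 : SameCycle.setoid (symmPerm G) ≤ Setoid.ker fun d => d.edge :=
    sameCycleSetoid_le_iff.2 fun x => (Dart.edge_symm x).symm
  have h5 : (f e).edge = (f e').edge := h4 h3
  rw [hf, hf] at h5
  exact Subtype.ext h5

theorem card_orbits_add_le (R : RotationSystem G) :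
    Nat.card (Quotient (SameCycle.setoid R.next ⊔ SameCycle.setoid (symmPerm G))) +
      Nat.card {v : V // ∀ w, ¬ G.Adj v w} ≤ Nat.card G.ConnectedComponent := by
  set s := SameCycle.setoid R.next ⊔ SameCycle.setoid (symmPerm G) with hs
  rw [← Nat.card_sum]
  have h1 : s ≤ Setoid.ker fun d : G.Dart => G.connectedComponentMk d.fst := by
    refine sup_le (sameCycleSetoid_le_iff.2 fun x => ?_) (sameCycleSetoid_le_iff.2 fun x => ?_)
    · change G.connectedComponentMk _ = G.connectedComponentMk _
      rw [R.fst_next]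
    · exact ConnectedComponent.sound x.adj.reachable
  have hfst : ∀ d d' : G.Dart, d.fst = d'.fst → s d d' := fun d d' h =>
    (le_sup_left : SameCycle.setoid R.next ≤ s) (R.sameCycle_of_fst_eq d d' h)
  have hsymm : ∀ d : G.Dart, s d d.symm := fun d =>
    (sameCycleSetoid_le_iff.1 (le_sup_right : SameCycle.setoid (symmPerm G) ≤ s)) d
  have hwalk : ∀ (u v : V), G.Walk u v → ∀ d d' : G.Dart, d.fst = u → d'.fst = v → s d d' := by
    intro u v p
    induction p with
    | nil => exact fun d d' h h' => hfst d d' (h.trans h'.symm)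
    | @cons u w v h p ih =>
      intro d d' hd hd'
      have e1 : s d ⟨(u, w), h⟩ := hfst _ _ hd
      exact s.trans' e1 (s.trans' (hsymm _) (ih _ d' rfl hd'))
  refine Nat.card_le_card_of_injective
    (Sum.elim (Quotient.lift (fun d : G.Dart => G.connectedComponentMk d.fst) h1)
      fun v => G.connectedComponentMk v.1) ?_
  have hiso : ∀ (v w : V), (∀ w, ¬ G.Adj v w) → G.Reachable v w → v = w := by
    rintro v w hv ⟨p⟩
    cases p with
    | nil => rfl
    | cons h p => exact absurd h (hv _)
  rintro (x | x) (y | y) hxy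
  · induction x using Quotient.inductionOn with | h x => ?_
    induction y using Quotient.inductionOn with | h y => ?_
    obtain ⟨p⟩ := ConnectedComponent.exact hxy
    exact congrArg Sum.inl (Quotient.sound (hwalk _ _ p x y rfl rfl))
  · induction x using Quotient.inductionOn with | h x => ?_
    have := hiso _ _ y.2 (ConnectedComponent.exact hxy).symm
    exact absurd (this ▸ x.adj) (y.2 _)
  · induction y using Quotient.inductionOn with | h y => ?_
    have := hiso _ _ x.2 (ConnectedComponent.exact hxy)
    exact absurd (this ▸ y.adj) (x.2 _)
  · exact congrArg Sum.inr (Subtype.ext (hiso _ _ x.2 (ConnectedComponent.exact hxy)))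

theorem IsSpherical.isPlanarMapOn {R : RotationSystem G} (h : R.IsSpherical) :
    IsPlanarMapOn R.next (symmPerm G) Set.univ := by
  classical
  refine ⟨fun _ _ => trivial, R.fst_next, fun d hd => absurd trivial hd,
    fun d _ d' _ => R.sameCycle_of_fst_eq d d', fun _ _ => rfl, fun d hd => absurd trivial hd, ?_⟩
  have := Fintype.ofFinite V
  have h1 := R.card_le_cycleCount_next_add
  have h2 := card_edgeSet_le_cycleCount_symm G
  have h3 := R.card_orbits_add_le
  have h4 : Nat.card G.Dart = 2 * Nat.card G.edgeSet := by
    rw [Nat.card_eq_fintype_card, G.dart_card_eq_twice_card_edges, Nat.card_eq_fintype_card,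
      ← edgeFinset_card]
  have h5 : Nat.card R.Face = cycleCount (R.next * symmPerm G) +
      Nat.card {v : V // ∀ w, ¬ G.Adj v w} := Nat.card_sum
  unfold IsSpherical at h
  unfold IsPlanarPair
  omega

end Recolouring.RotationSystem

/-! ### Euler's inequality for the induced subgraphs. -/

namespace Equiv.Perm

theorem mul_cycleCount_le_sum {D : Type*} [Fintype D] (π : Perm D) (w : D → ℕ) (m : ℕ)
    (h : ∀ x, ∃ A : Finset D, (∀ y ∈ A, SameCycle π x y) ∧ m ≤ ∑ y ∈ A, w y) :
    m * cycleCount π ≤ ∑ x, w x := by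
  classical
  have := Fintype.ofFinite (Quotient (SameCycle.setoid π))
  rw [cycleCount, Nat.card_eq_fintype_card, mul_comm, ← Finset.card_univ, ← smul_eq_mul,
    ← Finset.sum_fiberwise Finset.univ (Quotient.mk (SameCycle.setoid π)) w]
  refine Finset.card_nsmul_le_sum _ _ _ fun q _ => ?_
  induction q using Quotient.inductionOn with | h x => ?_
  obtain ⟨A, hA, hm⟩ := h x
  refine hm.trans (Finset.sum_le_sum_of_subset fun y hy => ?_)
  simp only [Finset.mem_filter, Finset.mem_univ, true_and]
  exact Quotient.sound (hA y hy).symm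

end Equiv.Perm

namespace SimpleGraph

open Equiv Equiv.Perm

variable {V : Type*} {G : SimpleGraph V}

namespace IsPlanarMapOn

variable {σ τ : Perm G.Dart} {T : Set G.Dart}

theorem face_fst (h : IsPlanarMapOn σ τ T) {d : G.Dart} (hd : d ∈ T) :
    ((σ * τ) d).fst = d.snd := by
  rw [mul_apply, h.fst_apply, h.edge_apply d hd]
  rfl

theorem face_mem (h : IsPlanarMapOn σ τ T) {d : G.Dart} (hd : d ∈ T) : (σ * τ) d ∈ T := by
  rw [mul_apply, h.edge_apply d hd]
  exact h.apply_mem (h.symm_mem d hd)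

theorem face_ne (h : IsPlanarMapOn σ τ T) {d : G.Dart} (hd : d ∈ T) : (σ * τ) d ≠ d := by
  intro k
  have := h.face_fst hd
  rw [k] at this
  exact d.fst_ne_snd this

/-- In a simple graph a face of length two runs along an edge and straight back, so it would turn at
a vertex of degree one. -/
theorem face_face_ne (h : IsPlanarMapOn σ τ T) (hσ : ∀ d ∈ T, σ d ≠ d) {d : G.Dart} (hd : d ∈ T) :
    (σ * τ) ((σ * τ) d) ≠ d := by
  intro k
  have h1 := h.face_fst (h.face_mem hd)
  rw [k] at h1
  have h2 : (σ * τ) d = d.symm := Dart.ext _ _ (Prod.ext (h.face_fst hd) h1.symm)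
  rw [mul_apply, h.edge_apply d hd] at h2
  exact hσ _ (h.symm_mem d hd) h2

/-- The two neighbours at a corner that belongs to a triangular face are adjacent. -/
theorem adj_of_face_eq (h : IsPlanarMapOn σ τ T) {d : G.Dart} (hd : d ∈ T)
    (h3 : (σ * τ) ((σ * τ) ((σ * τ) d.symm)) = d.symm) : G.Adj (σ d).snd d.snd := by
  have h1 : (σ * τ) d.symm = σ d := by
    rw [mul_apply, h.edge_apply _ (h.symm_mem d hd), Dart.symm_symm]
  rw [h1] at h3
  have h4 := h.face_fst (h.face_mem (h.apply_mem hd))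
  rw [h3] at h4
  have h5 := ((σ * τ) (σ d)).adj
  rw [h.face_fst (h.apply_mem hd), ← h4] at h5
  exact h5

variable [Fintype V]

open Classical in
/-- Euler's formula as a bound on the degrees, improved by the corners at non-triangular faces. -/
theorem euler_le (h : IsPlanarMapOn σ τ T) (hσ : ∀ d ∈ T, σ d ≠ d) (hT : T.Nonempty)
    {S : Finset V} (hS : ∀ d ∈ T, d.fst ∈ S) :
    24 + ∑ d with d ∈ T, (if (σ * τ) ((σ * τ) ((σ * τ) d)) = d then 0 else 1) +
      2 * (Finset.univ.filter (· ∈ T)).card ≤ 12 * S.card := by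
  set φ := σ * τ with hφ
  set a := (Finset.univ.filter (· ∈ T)).card with ha
  set b := (Finset.univ.filter (· ∉ T)).card with hb
  have hD : Nat.card G.Dart = a + b := by
    rw [Nat.card_eq_fintype_card, ← Finset.card_univ, ha, hb, Finset.card_filter_add_card_filter_not]
  have split : ∀ w : G.Dart → ℕ, (∀ d ∉ T, w d = 0) → ∀ m,
      ∑ d, (w d + if d ∈ T then 0 else m) = ∑ d with d ∈ T, w d + m * b := by
    intro w hw m
    rw [Finset.sum_add_distrib]
    congr 1
    · rw [Finset.sum_filter]
      exact Finset.sum_congr rfl fun d _ => by split_ifs with k; exacts [rfl, hw d k]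
    · rw [hb, Finset.card_filter, Finset.mul_sum]
      exact Finset.sum_congr rfl fun d _ => by split_ifs <;> simp
  have h1 : cycleCount σ ≤ S.card + b := by
    have hinj : Function.Injective (fun q : Quotient (SameCycle.setoid σ) =>
        if hq : q.out ∈ T then (Sum.inl ⟨q.out.fst, hS _ hq⟩ : S ⊕ {d : G.Dart // d ∉ T})
        else Sum.inr ⟨q.out, hq⟩) := by
      intro q q' hqq
      dsimp only at hqq
      split_ifs at hqq with k k' k'
      · have := congrArg Subtype.val (Sum.inl.inj hqq)
        have h6 : SameCycle σ q.out q'.out := h.sameCycle _ k _ k' this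
        rw [← q.out_eq, ← q'.out_eq]
        exact Quotient.sound h6
      · exact Quotient.out_injective (congrArg Subtype.val (Sum.inr.inj hqq))
    have := Nat.card_le_card_of_injective _ hinj
    rw [Nat.card_sum, Nat.card_eq_fintype_card (α := S), Fintype.card_coe,
      Nat.card_eq_fintype_card (α := {d : G.Dart // d ∉ T}), Fintype.card_subtype] at this
    exact this
  have h2 : 2 * cycleCount τ ≤ a + 2 * b := by
    have := mul_cycleCount_le_sum τ
      (fun d => (if d ∈ T then 1 else 0) + if d ∈ T then 0 else 2) 2 fun d => by
        by_cases hd : d ∈ T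
        · refine ⟨{d, d.symm}, ?_, ?_⟩
          · intro y hy
            rw [Finset.mem_insert, Finset.mem_singleton] at hy
            rcases hy with rfl | rfl
            · exact SameCycle.rfl
            · rw [← h.edge_apply _ hd]
              exact sameCycle_apply_right.2 SameCycle.rfl
          · rw [Finset.sum_pair d.symm_ne.symm]
            simp [hd, h.symm_mem d hd]
        · exact ⟨{d}, by simp [SameCycle.rfl], by simp [hd]⟩
    rw [split _ (fun d hd => by simp [hd])] at this
    rw [ha, Finset.card_eq_sum_ones]
    convert this using 2
    exact Finset.sum_congr rfl fun d hd => by simp [(Finset.mem_filter.1 hd).2]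
  -- A triangle gets `3 * 4 = 12`, and a longer face at least `4 * 3 = 12`.
  have h3 : 12 * cycleCount φ ≤
      ∑ d with d ∈ T, (if φ (φ (φ d)) = d then 4 else 3) + 12 * b := by
    have := mul_cycleCount_le_sum φ
      (fun d => (if d ∈ T then if φ (φ (φ d)) = d then 4 else 3 else 0) +
        if d ∈ T then 0 else 12) 12 fun d => by
        by_cases hd : d ∈ T
        · have m1 := h.face_mem hd
          have m2 := h.face_mem m1
          have m3 := h.face_mem m2
          have n1 := h.face_ne hd
          have n2 := h.face_face_ne hσ hd
          have s1 : SameCycle φ d (φ d) := sameCycle_apply_right.2 SameCycle.rfl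
          have s2 : SameCycle φ d (φ (φ d)) := sameCycle_apply_right.2 s1
          have s3 : SameCycle φ d (φ (φ (φ d))) := sameCycle_apply_right.2 s2
          rw [← hφ] at *
          by_cases n3 : φ (φ (φ d)) = d
          · refine ⟨{d, φ d, φ (φ d)}, ?_, ?_⟩
            · intro y hy
              simp only [Finset.mem_insert, Finset.mem_singleton] at hy
              rcases hy with rfl | rfl | rfl
              exacts [SameCycle.rfl, s1, s2]
            · rw [Finset.sum_insert, Finset.sum_pair]
              · simp [hd, m1, m2, n3]
              · exact fun k => n1 (φ.injective k.symm)
              · simp [n1.symm, n2.symm]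
          · refine ⟨{d, φ d, φ (φ d), φ (φ (φ d))}, ?_, ?_⟩
            · intro y hy
              simp only [Finset.mem_insert, Finset.mem_singleton] at hy
              rcases hy with rfl | rfl | rfl | rfl
              exacts [SameCycle.rfl, s1, s2, s3]
            · rw [Finset.sum_insert, Finset.sum_insert, Finset.sum_pair]
              · simp [hd, m1, m2, m3, n3]
              · exact fun k => n1 (φ.injective (φ.injective k.symm))
              · simp [n1.symm, n2.symm]
              · simp [n1.symm, n2.symm, Ne.symm n3]
        · exact ⟨{d}, by simp [SameCycle.rfl], by simp [hd]⟩
    rw [split _ (fun d hd => by simp [hd])] at this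
    convert this using 2
    exact Finset.sum_congr rfl fun d hd => by simp [(Finset.mem_filter.1 hd).2]
  -- Every dart outside `T` is an orbit by itself, and `T` contains at least one more.
  have h4 : b + 1 ≤ Nat.card (Quotient (SameCycle.setoid σ ⊔ SameCycle.setoid τ)) := by
    let f : G.Dart → Option {d : G.Dart // d ∉ T} := fun d => if hd : d ∈ T then none else some ⟨d, hd⟩
    have hf : SameCycle.setoid σ ⊔ SameCycle.setoid τ ≤ Setoid.ker f := by
      refine sup_le (sameCycleSetoid_le_iff.2 fun x => ?_) (sameCycleSetoid_le_iff.2 fun x => ?_)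
      · change f x = f (σ x)
        by_cases hx : x ∈ T
        · simp [f, hx, h.apply_mem hx]
        · rw [h.apply_of_notMem x hx]
      · change f x = f (τ x)
        by_cases hx : x ∈ T
        · simp [f, hx, h.edge_apply x hx, h.symm_mem x hx]
        · rw [h.edge_apply_of_notMem x hx]
    have hsurj : Function.Surjective (Quotient.lift f hf) := by
      obtain ⟨d, hd⟩ := hT
      rintro (_ | ⟨x, hx⟩)
      · exact ⟨Quotient.mk _ d, by simp [f, hd]⟩
      · exact ⟨Quotient.mk _ x, by simp [f, hx]⟩
    have := Nat.card_le_card_of_surjective _ hsurj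
    rwa [Nat.card_eq_fintype_card, Fintype.card_option, Fintype.card_subtype] at this
  have h5 : ∑ d with d ∈ T, (if φ (φ (φ d)) = d then 4 else 3) +
      ∑ d with d ∈ T, (if φ (φ (φ d)) = d then 0 else 1) = 4 * a := by
    rw [← Finset.sum_add_distrib, ha, Finset.card_eq_sum_ones, Finset.mul_sum]
    exact Finset.sum_congr rfl fun d _ => by split_ifs <;> rfl
  -- Twelve times the Euler inequality, with `h1` to `h5` inserted; all terms in `b` cancel.
  have h6 := h.planar
  unfold IsPlanarPair at h6
  rw [← hφ] at h6
  omega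

end IsPlanarMapOn

/-! ### Discharging: the reducible configurations. -/

variable [Fintype V]

open Classical in
/-- The degree of `v` in the subgraph induced by `S`. -/
noncomputable def degreeIn (G : SimpleGraph V) (S : Finset V) (v : V) : ℕ :=
  (S.filter (G.Adj v)).card

-- Double counting of the darts inside `S`, grouped by their initial vertex.
open Classical in
theorem sum_darts_fst (S : Finset V) (g : V → ℕ) (p : V → Prop) [DecidablePred p] :
    ∑ d : G.Dart with d.fst ∈ S ∧ d.snd ∈ S, (if p d.snd then g d.fst else 0) =
      ∑ v ∈ S, (S.filter fun u => G.Adj v u ∧ p u).card * g v := by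
  rw [← Finset.sum_fiberwise_of_maps_to (s := Finset.univ.filter
    fun d : G.Dart => d.fst ∈ S ∧ d.snd ∈ S) (t := S) (g := fun d => d.fst)
    fun d hd => (Finset.mem_filter.1 hd).2.1]
  refine Finset.sum_congr rfl fun v hv => ?_
  rw [← smul_eq_mul, ← Finset.sum_const, ← Finset.sum_filter]
  refine Finset.sum_bij' (fun d _ => d.snd)
    (fun u hu => ⟨(v, u), (Finset.mem_filter.1 hu).2.1⟩) ?_ ?_ ?_ ?_ ?_
  · intro d hd
    simp only [Finset.mem_filter, Finset.mem_univ, true_and] at hd ⊢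
    exact ⟨hd.1.1.2, hd.1.2 ▸ d.adj, hd.2⟩
  · intro u hu
    simp only [Finset.mem_filter, Finset.mem_univ, true_and] at hu ⊢
    exact ⟨⟨⟨hv, hu.1⟩, trivial⟩, hu.2.2⟩
  · intro d hd
    simp only [Finset.mem_filter, Finset.mem_univ, true_and] at hd
    exact Dart.ext _ _ (Prod.ext hd.1.2.symm rfl)
  · intro u hu
    rfl
  · intro d hd
    simp only [Finset.mem_filter, Finset.mem_univ, true_and] at hd
    rw [hd.1.2]

open Classical in
/-- Every nonempty induced subgraph of a planar graph contains a vertex with at most four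
neighbours of degree other than five, or a triangle with degrees `5`, `6`, `6`. -/
theorem IsPlanarMapOn.exists_reducible {σ τ : Perm G.Dart} (h₀ : IsPlanarMapOn σ τ Set.univ)
    {S : Finset V} (hS : S.Nonempty) :
    (∃ v ∈ S, G.degreeIn S v ≤ 4 + (S.filter fun u => G.Adj v u ∧ G.degreeIn S u = 5).card) ∨
    ∃ u ∈ S, ∃ v ∈ S, ∃ w ∈ S, G.Adj u v ∧ G.Adj u w ∧ G.Adj v w ∧
      G.degreeIn S u = 5 ∧ G.degreeIn S v = 6 ∧ G.degreeIn S w = 6 := by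
  by_contra hcon
  push Not at hcon
  obtain ⟨hC, hD⟩ := hcon
  obtain ⟨σ, τ, h⟩ := h₀.exists_induce (S : Set V)
  clear h₀
  set T : Set G.Dart := {d | d.fst ∈ (S : Set V) ∧ d.snd ∈ (S : Set V)} with hT
  set deg := G.degreeIn S with hdeg
  have hmem : ∀ d : G.Dart, d ∈ T ↔ d.fst ∈ S ∧ d.snd ∈ S := fun d => Iff.rfl
  have h5 : ∀ v ∈ S, 5 ≤ deg v := fun v hv => by have := hC v hv; omega
  have hσ : ∀ d ∈ T, σ d ≠ d := by
    intro d hd k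
    have : S.filter (G.Adj d.fst) ⊆ {d.snd} := by
      intro u hu
      rw [Finset.mem_filter] at hu
      have e : SameCycle σ d ⟨(d.fst, u), hu.2⟩ := h.sameCycle d hd _ ⟨hd.1, hu.1⟩ rfl
      rw [Finset.mem_singleton, e.eq_of_left k]
    have h1 := Finset.card_le_card this
    have h2 := h5 _ hd.1
    rw [Finset.card_singleton] at h1
    simp only [hdeg, degreeIn] at h2
    omega
  have hTne : T.Nonempty := by
    obtain ⟨v, hv⟩ := hS
    have : 0 < (S.filter (G.Adj v)).card := lt_of_lt_of_le (by norm_num) (h5 v hv)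
    obtain ⟨u, hu⟩ := Finset.card_pos.1 this
    rw [Finset.mem_filter] at hu
    exact ⟨⟨(v, u), hu.2⟩, hv, hu.1⟩
  have hE := h.euler_le hσ hTne (S := S) fun d hd => hd.1
  set φ := σ * τ with hφ
  set X : G.Dart → ℕ := fun d => if φ (φ (φ d)) = d then 0 else 1 with hX
  set H : V → ℕ := fun v => if 7 ≤ deg v then 1 else 0 with hH
  set B : V → ℕ := fun v => if deg v = 5 then 1 else 0 with hB
  set F : Finset G.Dart := Finset.univ.filter (· ∈ T) with hF
  have hFT : ∀ d, d ∈ F ↔ d ∈ T := fun d => by simp [hF]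
  have hFS : F = Finset.univ.filter fun d : G.Dart => d.fst ∈ S ∧ d.snd ∈ S := by
    ext d; rw [hFT, hmem]; simp
  -- At a corner of a 5-vertex both neighbours have degree at least 6, since two adjacent 5-vertices
  -- violate `hC`. If the face is a triangle, they are adjacent and by `hD` not both of degree 6, so
  -- one has degree at least 7.
  have hcorner : ∀ d ∈ F, B d.fst ≤
      2 * X d.symm + B d.fst * H d.snd + B d.fst * H (σ d).snd := by
    intro d hd
    rw [hFT] at hd
    by_cases hb : deg d.fst = 5
    · simp only [hB, hb, if_true, one_mul]
      by_cases hx : φ (φ (φ d.symm)) = d.symm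
      · have hadj := h.adj_of_face_eq hd hx
        have hd' := h.apply_mem hd
        have six : ∀ e : G.Dart, e ∈ T → e.fst = d.fst → deg e.snd ≠ 5 := by
          intro e he hed k
          have h1 := hC _ hd.1
          have h2 : 0 < (S.filter fun u => G.Adj d.fst u ∧ deg u = 5).card :=
            Finset.card_pos.2 ⟨e.snd, Finset.mem_filter.2 ⟨he.2, hed ▸ e.adj, k⟩⟩
          omega
        have e1 := six d hd rfl
        have e2 := six (σ d) hd' (h.fst_apply d)
        have e3 := h5 _ hd.2
        have e4 := h5 _ hd'.2
        have e5 := hD _ hd.1 _ hd.2 _ hd'.2 d.adj (h.fst_apply d ▸ (σ d).adj) hadj.symm hb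
        simp only [hH]
        by_cases k : 7 ≤ deg d.snd
        · rw [if_pos k]; omega
        · by_cases k' : 7 ≤ deg (σ d).snd
          · rw [if_pos k']; omega
          · exact absurd (by omega) (e5 (by omega))
      · simp only [hX, if_neg hx]
        omega
    · simp [hB, hb]
  have hsum := Finset.sum_le_sum hcorner
  rw [Finset.sum_add_distrib, Finset.sum_add_distrib, ← Finset.mul_sum] at hsum
  have hsymm : ∀ g : G.Dart → ℕ, ∑ d ∈ F, g d.symm = ∑ d ∈ F, g d := fun g =>
    Finset.sum_bij' (fun d _ => d.symm) (fun d _ => d.symm)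
      (fun d hd => (hFT _).2 (h.symm_mem d ((hFT d).1 hd)))
      (fun d hd => (hFT _).2 (h.symm_mem d ((hFT d).1 hd))) (fun d _ => d.symm_symm)
      (fun d _ => d.symm_symm) fun d _ => rfl
  have hrot : ∑ d ∈ F, B d.fst * H (σ d).snd = ∑ d ∈ F, B d.fst * H d.snd := by
    refine Finset.sum_equiv σ (fun d => ?_) fun d _ => by rw [h.fst_apply]
    rw [hFT, hFT]
    refine ⟨h.apply_mem, fun k => ?_⟩
    by_contra k'
    rw [h.apply_of_notMem d k'] at k
    exact k' k
  -- Counted from the other end: by `hC` a vertex `v` has at most `deg v - 5` neighbours of degree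
  -- 5.
  have hN : ∑ d ∈ F, B d.fst * H d.snd ≤ ∑ v ∈ S, (deg v - 5) * H v := by
    rw [← hsymm, hFS]
    have := sum_darts_fst (G := G) S H fun u => deg u = 5
    calc _ = _ := Finset.sum_congr rfl fun d _ => by
            change B d.snd * H d.fst = if deg d.snd = 5 then H d.fst else 0
            simp only [hB, ite_mul, one_mul, zero_mul]
      _ = _ := this
      _ ≤ _ := Finset.sum_le_sum fun v hv => Nat.mul_le_mul_right _ (by have := hC v hv; omega)
  have hdart : ∀ g : V → ℕ, ∑ d ∈ F, g d.fst = ∑ v ∈ S, deg v * g v := by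
    intro g
    have := sum_darts_fst (G := G) S g fun _ => True
    simp only [if_true, and_true] at this
    rw [hFS, this]
    rfl
  rw [hrot, hsymm X, hdart B] at hsum
  have hcardF : F.card = ∑ v ∈ S, deg v := by
    rw [Finset.card_eq_sum_ones, hdart fun _ => 1]
    simp
  -- Equality holds for degrees 5, 6 and 7.
  have hpoint : ∑ v ∈ S, (12 + (deg v - 5) * H v) ≤ ∑ v ∈ S, (2 * B v + 2 * deg v) := by
    refine Finset.sum_le_sum fun v hv => ?_
    have := h5 v hv
    simp only [hH, hB]
    split_ifs <;> omega
  have hB5 : ∑ v ∈ S, deg v * B v = 5 * ∑ v ∈ S, B v := by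
    rw [Finset.mul_sum]
    refine Finset.sum_congr rfl fun v _ => ?_
    by_cases k : deg v = 5 <;> simp [hB, k]
  rw [Finset.sum_add_distrib, Finset.sum_add_distrib, Finset.sum_const, ← Finset.mul_sum,
    ← Finset.mul_sum, smul_eq_mul] at hpoint
  have hE' : 24 + ∑ d ∈ F, X d + 2 * F.card ≤ 12 * S.card := by convert hE
  -- Let `x = ∑ X`, `y = ∑ (deg v - 5) * H v` and `z = ∑ B`. The corners give `5 * z ≤ 2 * x + 2 *
  -- y`, while Euler and `hpoint` give `24 + x + y ≤ 2 * z`, a contradiction.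
  omega

end SimpleGraph

/-! ### Recolouring sequences and their extension by a vertex. -/

namespace Recolouring

open SimpleGraph

variable {V α : Type*} (G : SimpleGraph V) (L : V → Set α)

/-- `f` restricts to an `L`-colouring of the subgraph of `G` induced by `S`. -/
def IsColouringOn (S : Finset V) (f : V → α) : Prop :=
  (∀ x ∈ S, f x ∈ L x) ∧ ∀ x ∈ S, ∀ y ∈ S, G.Adj x y → f x ≠ f y

variable {G L}

theorem IsColouringOn.mono {S S' : Finset V} {f : V → α} (h : IsColouringOn G L S f)
    (hS : S' ⊆ S) : IsColouringOn G L S' f :=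
  ⟨fun x hx => h.1 x (hS hx), fun x hx y hy => h.2 x (hS hx) y (hS hy)⟩

theorem IsColouringOn.congr {S : Finset V} {f f' : V → α} (h : IsColouringOn G L S f)
    (hf : ∀ x ∈ S, f x = f' x) : IsColouringOn G L S f' :=
  ⟨fun x hx => hf x hx ▸ h.1 x hx, fun x hx y hy => hf x hx ▸ hf y hy ▸ h.2 x hx y hy⟩

variable [DecidableEq V]

theorem IsColouringOn.insert_vertex {S : Finset V} {f : V → α} {v : V} (h : IsColouringOn G L S f)
    (hv : f v ∈ L v) (hN : ∀ x ∈ S, G.Adj v x → f x ≠ f v) :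
    IsColouringOn G L (insert v S) f := by
  constructor
  · intro x hx
    rcases Finset.mem_insert.1 hx with rfl | hx
    exacts [hv, h.1 x hx]
  · intro x hx y hy hxy
    rcases Finset.mem_insert.1 hx with hx' | hx' <;> rcases Finset.mem_insert.1 hy with hy' | hy'
    · exact absurd (hx'.trans hy'.symm) hxy.ne
    · exact hx' ▸ (hN y hy' (hx' ▸ hxy)).symm
    · exact hy' ▸ hN x hx' (hy' ▸ hxy.symm)
    · exact h.2 x hx' y hy' hxy

variable (G L) in
/-- The list of recolourings `ms` leads from `f` to `g` through `L`-colourings of the subgraph of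
`G` induced by `S`. -/
inductive RecolourSeq (S : Finset V) : (V → α) → List (V × α) → (V → α) → Prop
  | nil {f g} : IsColouringOn G L S f → (∀ x ∈ S, f x = g x) → RecolourSeq S f [] g
  | cons {f g x a ms} : IsColouringOn G L S f → x ∈ S →
      RecolourSeq S (Function.update f x a) ms g → RecolourSeq S f ((x, a) :: ms) g

/-- The number of times that `x` is recoloured by the list of recolourings `ms`. -/
def moveCount (ms : List (V × α)) (x : V) : ℕ := (ms.map Prod.fst).count x

theorem moveCount_cons (x : V) (a : α) (ms : List (V × α)) (y : V) :
    moveCount ((x, a) :: ms) y = moveCount ms y + if x = y then 1 else 0 := by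
  simp [moveCount, List.count_cons]

theorem length_filter_eq_sum_moveCount (N : Finset V) (ms : List (V × α)) :
    (ms.filter (·.1 ∈ N)).length = ∑ x ∈ N, moveCount ms x := by
  induction ms with
  | nil => simp [moveCount]
  | cons p ms ih =>
    obtain ⟨x, a⟩ := p
    simp only [moveCount_cons, Finset.sum_add_distrib, ← ih, Finset.sum_ite_eq, List.filter_cons]
    by_cases h : x ∈ N <;> simp [h]

theorem RecolourSeq.isColouringOn {S : Finset V} {f g : V → α} {ms : List (V × α)}
    (h : RecolourSeq G L S f ms g) : IsColouringOn G L S f := by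
  cases h <;> assumption

/-- Values outside `S` play no role, so a new vertex can be recoloured without disturbing the
sequence on `S`. -/
theorem RecolourSeq.congr {S : Finset V} {f f' g : V → α} {ms : List (V × α)}
    (h : RecolourSeq G L S f ms g) (hf : ∀ x ∈ S, f x = f' x) : RecolourSeq G L S f' ms g := by
  induction h generalizing f' with
  | nil h1 h2 => exact .nil (h1.congr hf) fun x hx => (hf x hx).symm.trans (h2 x hx)
  | @cons f g x a ms h1 hx _ ih =>
    refine .cons (h1.congr hf) hx (ih fun y hy => ?_)
    rcases eq_or_ne y x with rfl | hyx
    · simp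
    · simp [hyx, hf y hy]

theorem RecolourSeq.concat {S : Finset V} {f g : V → α} {ms : List (V × α)} {v : V} {a : α}
    (h : RecolourSeq G L S f ms g) (hv : v ∈ S)
    (hg : IsColouringOn G L S (Function.update g v a)) :
    RecolourSeq G L S f (ms ++ [(v, a)]) (Function.update g v a) := by
  induction h with
  | @nil f g h1 h2 =>
    have e : ∀ x ∈ S, Function.update g v a x = Function.update f v a x := by
      intro x hx
      rcases eq_or_ne x v with rfl | hxv
      · simp
      · simp [hxv, h2 x hx]
    exact .cons h1 hv (.nil (hg.congr e) fun x hx => (e x hx).symm)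
  | cons h1 hx _ ih => exact .cons h1 hx (ih hg)

theorem exists_mem_notMem_of_card_lt {A : Set α} {F : Finset α} {n : ℕ} (hF : F.card < n)
    (hA : (n : ℕ∞) ≤ A.encard) : ∃ b ∈ A, b ∉ F := by
  by_contra! h
  have h1 := Set.encard_le_encard (s := A) (t := F) h
  rw [Set.encard_coe_eq_coe_finsetCard] at h1
  have := Nat.cast_le.1 (hA.trans h1)
  omega

/-- Extending a recolouring sequence by a vertex `v`: whenever `v` is in the way, it moves to a
colour that is not going to be used in the next `s` recolourings of its neighbours. -/
theorem RecolourSeq.exists_insert_aux {S N : Finset V} {v : V} {d s : ℕ} (hv : v ∉ S)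
    (hN : ∀ x, x ∈ N ↔ x ∈ S ∧ G.Adj v x) (hd : N.card ≤ d) (hs : 1 ≤ s)
    (hL : ((d + s + 1 : ℕ) : ℕ∞) ≤ (L v).encard) (g : V → α) (ms : List (V × α)) :
    ∀ (f : V → α) (r : ℕ), r ≤ s → RecolourSeq G L S f ms g →
      IsColouringOn G L (insert v S) f →
      f v ∉ ((ms.filter (·.1 ∈ N)).map Prod.snd).take r →
      ∃ ms' b, RecolourSeq G L (insert v S) f ms' (Function.update g v b) ∧
        (∀ x, x ≠ v → moveCount ms' x = moveCount ms x) ∧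
        moveCount ms' v ≤ ((ms.filter (·.1 ∈ N)).length - r + (s - 1)) / s := by
  classical
  have hSv : ∀ x ∈ S, x ≠ v := fun x hx k => hv (k ▸ hx)
  induction ms with
  | nil =>
    rintro f r - (⟨h1, h2⟩ | _) hf -
    refine ⟨[], f v, .nil hf fun x hx => ?_, fun _ _ => rfl, by simp [moveCount]⟩
    rcases Finset.mem_insert.1 hx with rfl | hx
    · simp
    · rw [Function.update_of_ne (hSv x hx), h2 x hx]
  | cons p ms ih =>
    rintro f r hr (_ | @⟨_, _, x, a, _, h1, hx, h2⟩) hf hfr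
    have hxv : x ≠ v := hSv x hx
    have hvx := hxv.symm
    by_cases hxN : x ∈ N
    · simp only [List.filter_cons, hxN, decide_true, if_true, List.map_cons,
        List.length_cons] at hfr ⊢
      cases r with
      | zero =>
        -- No guarantee is left and a neighbour moves next. At most `d` current colours and `s`
        -- future ones are forbidden, so one of `d + s + 1` colours is free; afterwards the counter
        -- `r` restarts.
        obtain ⟨b, hbL, hbF⟩ := exists_mem_notMem_of_card_lt (A := L v) (n := d + s + 1)
          (F := N.image f ∪ ((a :: (ms.filter (·.1 ∈ N)).map Prod.snd).take s).toFinset) (by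
            refine Nat.lt_succ_of_le ((Finset.card_union_le _ _).trans (Nat.add_le_add
              (Finset.card_image_le.trans hd) ((List.toFinset_card_le _).trans ?_)))
            rw [List.length_take]
            exact min_le_left _ _) hL
        obtain ⟨s, rfl⟩ : ∃ k, s = k + 1 := ⟨s - 1, by omega⟩
        simp only [Finset.mem_union, Finset.mem_image, List.mem_toFinset, not_or, not_exists,
          not_and, List.take_succ_cons, List.mem_cons] at hbF
        obtain ⟨hb1, hb2, hb3⟩ := hbF
        have hf1 : IsColouringOn G L (insert v S) (Function.update f v b) := by
          refine IsColouringOn.insert_vertex (h1.congr fun y hy => ?_) (by simpa) fun y hy hvy => ?_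
          · rw [Function.update_of_ne (hSv y hy)]
          · rw [Function.update_of_ne (hSv y hy), Function.update_self]
            exact hb1 y ((hN y).2 ⟨hy, hvy⟩)
        have hc : ∀ y ∈ S, Function.update f x a y =
            Function.update (Function.update f v b) x a y := by
          intro y hy
          rw [Function.update_comm hvx, Function.update_of_ne (hSv y hy)]
        have h3 := h2.congr hc
        have hf2 : IsColouringOn G L (insert v S)
            (Function.update (Function.update f v b) x a) := by
          refine IsColouringOn.insert_vertex h3.isColouringOn (by simpa [hvx]) fun y hy hvy => ?_
          rw [Function.update_of_ne hvx, Function.update_self]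
          rcases eq_or_ne y x with rfl | hyx
          · rw [Function.update_self]
            exact Ne.symm hb2
          · rw [Function.update_of_ne hyx, Function.update_of_ne (hSv y hy)]
            exact hb1 y ((hN y).2 ⟨hy, hvy⟩)
        obtain ⟨ms', b', i1, i2, i3⟩ := ih _ s (by omega) h3 hf2
          (by rwa [Function.update_of_ne hvx, Function.update_self])
        refine ⟨(v, b) :: (x, a) :: ms', b', .cons hf (Finset.mem_insert_self _ _)
          (.cons hf1 (Finset.mem_insert_of_mem hx) i1), fun y hy => ?_, ?_⟩
        · simp [moveCount_cons, i2 y hy, hy.symm]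
        · simp only [moveCount_cons, if_true, if_neg hxv]
          set n := (ms.filter (·.1 ∈ N)).length
          have h4 : (n + 1 - 0 + (s + 1 - 1)) / (s + 1) = n / (s + 1) + 1 := by
            rw [← Nat.add_div_right _ (Nat.succ_pos s)]
            congr 1
            omega
          rw [h4]
          -- The counter restarts at the old `s - 1`, as the pending move uses up one of the avoided
          -- colours. If fewer moves remain, the truncated difference is zero.
          have h5 : (n - s + (s + 1 - 1)) / (s + 1) ≤ n / (s + 1) := by
            rcases le_total s n with k | k
            · apply Nat.div_le_div_right
              omega
            · rw [Nat.sub_eq_zero_of_le k, Nat.div_eq_of_lt (by omega)]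
              exact Nat.zero_le _
          omega
      | succ r =>
        simp only [List.take_succ_cons, List.mem_cons, not_or] at hfr
        have hf2 : IsColouringOn G L (insert v S) (Function.update f x a) := by
          refine IsColouringOn.insert_vertex h2.isColouringOn ?_ fun y hy hvy => ?_
          · rw [Function.update_of_ne hvx]
            exact hf.1 v (Finset.mem_insert_self _ _)
          · rw [Function.update_of_ne hvx]
            rcases eq_or_ne y x with rfl | hyx
            · rw [Function.update_self]
              exact Ne.symm hfr.1
            · rw [Function.update_of_ne hyx]
              exact hf.2 y (Finset.mem_insert_of_mem hy) v (Finset.mem_insert_self _ _) hvy.symm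
        obtain ⟨ms', b', i1, i2, i3⟩ := ih _ r (by omega) h2 hf2
          (by rw [Function.update_of_ne hvx]; exact hfr.2)
        refine ⟨(x, a) :: ms', b', .cons hf (Finset.mem_insert_of_mem hx) i1, fun y hy => ?_, ?_⟩
        · simp [moveCount_cons, i2 y hy]
        · rw [moveCount_cons, if_neg hxv, Nat.add_sub_add_right]
          exact i3
    · simp only [List.filter_cons, hxN, decide_false, Bool.false_eq_true, if_false] at hfr ⊢
      have hf2 : IsColouringOn G L (insert v S) (Function.update f x a) := by
        refine IsColouringOn.insert_vertex h2.isColouringOn ?_ fun y hy hvy => ?_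
        · rw [Function.update_of_ne hvx]
          exact hf.1 v (Finset.mem_insert_self _ _)
        · have hyx : y ≠ x := fun k => hxN ((hN x).2 (k ▸ ⟨hy, hvy⟩))
          rw [Function.update_of_ne hvx, Function.update_of_ne hyx]
          exact hf.2 y (Finset.mem_insert_of_mem hy) v (Finset.mem_insert_self _ _) hvy.symm
      obtain ⟨ms', b', i1, i2, i3⟩ := ih _ r hr h2 hf2 (by rwa [Function.update_of_ne hvx])
      refine ⟨(x, a) :: ms', b', .cons hf (Finset.mem_insert_of_mem hx) i1, fun y hy => ?_, ?_⟩
      · simp [moveCount_cons, i2 y hy]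
      · rw [moveCount_cons, if_neg hxv]
        exact i3

variable (G L) in
/-- The subgraph induced by `S` can be recoloured from `f` to `g`, each vertex `x` of `S` being
recoloured at most `m x` times. -/
def RecolourableWithin (S : Finset V) (f g : V → α) (m : V → ℕ) : Prop :=
  ∃ ms, RecolourSeq G L S f ms g ∧ ∀ x ∈ S, moveCount ms x ≤ m x

/-- The extended sequence leaves `v` with an uncontrolled colour `b`; the `+ 1` in `hk` pays for the
last move to `g v`. -/
theorem RecolourableWithin.insert_vertex {S N : Finset V} {f g : V → α} {m : V → ℕ} {v : V} {d s k : ℕ}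
    (h : RecolourableWithin G L S f g m) (hv : v ∉ S) (hN : ∀ x, x ∈ N ↔ x ∈ S ∧ G.Adj v x)
    (hd : N.card ≤ d) (hs : 1 ≤ s) (hL : ((d + s + 1 : ℕ) : ℕ∞) ≤ (L v).encard)
    (hf : IsColouringOn G L (insert v S) f) (hg : IsColouringOn G L (insert v S) g)
    (hk : (∑ x ∈ N, m x + (s - 1)) / s + 1 ≤ k) :
    RecolourableWithin G L (insert v S) f g (Function.update m v k) := by
  obtain ⟨ms, h1, h2⟩ := h
  obtain ⟨ms', b, i1, i2, i3⟩ := RecolourSeq.exists_insert_aux hv hN hd hs hL g ms f 0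
    (Nat.zero_le _) h1 hf (by simp)
  have e : Function.update (Function.update g v b) v (g v) = g := by simp
  have h3 := i1.concat (v := v) (a := g v) (Finset.mem_insert_self _ _) (by rwa [e])
  rw [e] at h3
  have hcount : ∀ x, moveCount (ms' ++ [(v, g v)]) x = moveCount ms' x + if v = x then 1 else 0 := by
    intro x
    simp [moveCount, List.count_cons]
  refine ⟨_, h3, fun x hx => ?_⟩
  rw [hcount]
  rcases Finset.mem_insert.1 hx with rfl | hx
  · rw [Function.update_self, if_pos rfl]
    refine le_trans (Nat.add_le_add_right (i3.trans (Nat.div_le_div_right ?_)) 1) hk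
    rw [length_filter_eq_sum_moveCount, Nat.sub_zero]
    exact Nat.add_le_add_right (Finset.sum_le_sum fun y hy => h2 y ((hN y).1 hy).1) _
  · have hxv : x ≠ v := fun k => hv (k ▸ hx)
    rw [Function.update_of_ne hxv, if_neg hxv.symm, i2 x hxv]
    exact h2 x hx

variable {S N : Finset V} {f g : V → α} {m : V → ℕ} {v : V}

/-- Here `11 = 4 + 6 + 1` and `68 = ⌈400 / 6⌉ + 1`. -/
theorem RecolourableWithin.insert_of_card_le_four
    (h : RecolourableWithin G L S f g m) (hm : ∀ x, m x ≤ 100) (hv : v ∉ S)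
    (hN : ∀ x, x ∈ N ↔ x ∈ S ∧ G.Adj v x) (hd : N.card ≤ 4) (hL : 11 ≤ (L v).encard)
    (hf : IsColouringOn G L (insert v S) f) (hg : IsColouringOn G L (insert v S) g) :
    RecolourableWithin G L (insert v S) f g (Function.update m v 68) := by
  refine h.insert_vertex hv hN hd (s := 6) (by norm_num) (by exact_mod_cast hL) hf hg ?_
  have : ∑ x ∈ N, m x ≤ _ := Finset.sum_le_card_nsmul N m 100 fun x _ => hm x
  rw [smul_eq_mul] at this
  omega

/-- Here `11 = 5 + 5 + 1` and `95 = ⌈(68 + 4 * 100) / 5⌉ + 1`; the cheap neighbour `w` is what keeps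
the count below 100. -/
theorem RecolourableWithin.insert_of_card_le_five {w : V}
    (h : RecolourableWithin G L S f g m) (hm : ∀ x, m x ≤ 100) (hv : v ∉ S)
    (hN : ∀ x, x ∈ N ↔ x ∈ S ∧ G.Adj v x) (hd : N.card ≤ 5) (hw : w ∈ N) (hmw : m w ≤ 68)
    (hL : 11 ≤ (L v).encard)
    (hf : IsColouringOn G L (insert v S) f) (hg : IsColouringOn G L (insert v S) g) :
    RecolourableWithin G L (insert v S) f g (Function.update m v 95) := by
  refine h.insert_vertex hv hN hd (s := 5) (by norm_num) (by exact_mod_cast hL) hf hg ?_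
  have : ∑ x ∈ N.erase w, m x ≤ _ := Finset.sum_le_card_nsmul (N.erase w) m 100 fun x _ => hm x
  rw [smul_eq_mul, Finset.card_erase_of_mem hw] at this
  have := Finset.add_sum_erase N m hw
  omega

end Recolouring

/-! ### The induction, and the passage to walks in the recolouring graph. -/

namespace Recolouring

open SimpleGraph

variable {V α : Type*} {G : SimpleGraph V} {L : V → Set α}

theorem recolourableWithin_hundred [Fintype V] [DecidableEq V] (hG : IsPlanar G)
    (hL : ∀ v, 11 ≤ (L v).encard) (S : Finset V) :
    ∀ f g : V → α, IsColouringOn G L S f → IsColouringOn G L S g →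
      RecolourableWithin G L S f g fun _ => 100 := by
  classical
  obtain ⟨R, hR⟩ := hG
  induction S using Finset.strongInduction with | H S ih => ?_
  intro f g hf hg
  rcases S.eq_empty_or_nonempty with rfl | hS
  · exact ⟨[], .nil hf (by simp), by simp⟩
  have hfilter : ∀ (A : Finset V) (v x : V), x ∈ A.filter (G.Adj v) ↔ x ∈ A ∧ G.Adj v x :=
    fun A v x => Finset.mem_filter
  rcases hR.isPlanarMapOn.exists_reducible hS with ⟨v, hv, hdeg⟩ | ⟨u, hu, v, hv, w, hw, h⟩
  · set A := S.filter fun u => G.Adj v u ∧ G.degreeIn S u = 5 with hA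
    have hAS : A ⊆ S := Finset.filter_subset _ _
    have hvA : v ∉ A := fun k => ((Finset.mem_filter.1 k).2.1).ne rfl
    have hsub : insert v (S \ insert v A) ⊆ S :=
      Finset.insert_subset hv Finset.sdiff_subset
    have h0 := (ih (S \ insert v A) (Finset.ssubset_iff_subset_ne.2 ⟨Finset.sdiff_subset,
      fun k => by rw [← k] at hv; simp at hv⟩) f g
      (hf.mono Finset.sdiff_subset) (hg.mono Finset.sdiff_subset)).insert_of_card_le_four
      (v := v) (fun _ => le_rfl) (by simp) (hfilter _ v) (by
        have e : (S \ insert v A).filter (G.Adj v) = S.filter (G.Adj v) \ A := by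
          ext x
          simp only [Finset.mem_filter, Finset.mem_sdiff, Finset.mem_insert, not_or]
          exact ⟨fun k => ⟨⟨k.1.1, k.2⟩, k.1.2.2⟩, fun k => ⟨⟨k.1.1, k.1.2.ne', k.2⟩, k.1.2⟩⟩
        rw [e, Finset.card_sdiff_of_subset]
        · simp only [degreeIn] at hdeg
          omega
        · exact Finset.monotone_filter_right S fun x _ k => k.1) (hL v) (hf.mono hsub) (hg.mono hsub)
    -- The vertices of `A` return one at a time after `v`. Each has degree 5 in `S` and is adjacent
    -- to `v`, whose count stays at most 68.
    have key : ∀ B ⊆ A, ∃ m : V → ℕ, m v ≤ 68 ∧ (∀ x, m x ≤ 100) ∧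
        RecolourableWithin G L (B ∪ insert v (S \ insert v A)) f g m := by
      intro B
      induction B using Finset.induction_on with
      | empty =>
        intro _
        refine ⟨_, ?_, fun x => ?_, by rw [Finset.empty_union]; exact h0⟩
        · simp
        · rcases eq_or_ne x v with rfl | k <;> simp [*]
      | insert u B huB ihB =>
        intro hB
        rw [Finset.insert_subset_iff] at hB
        obtain ⟨m, hmv, hm, hr⟩ := ihB hB.2
        have huv : u ≠ v := fun k => hvA (k ▸ hB.1)
        have huA := (Finset.mem_filter.1 hB.1).2
        have hsub' : B ∪ insert v (S \ insert v A) ⊆ S :=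
          Finset.union_subset (hB.2.trans hAS) hsub
        have hsub'' : insert u (B ∪ insert v (S \ insert v A)) ⊆ S :=
          Finset.insert_subset (hAS hB.1) hsub'
        rw [Finset.insert_union]
        refine ⟨_, ?_, ?_, hr.insert_of_card_le_five (w := v) hm ?_ (hfilter _ u) ?_ ?_ hmv (hL u)
          (hf.mono hsub'') (hg.mono hsub'')⟩
        · rwa [Function.update_of_ne huv.symm]
        · intro x
          rcases eq_or_ne x u with rfl | k <;> simp [*]
        · simp [huB, huv, hB.1]
        · exact (Finset.card_le_card (Finset.filter_subset_filter _ hsub')).trans huA.2.le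
        · simp [huA.1.symm]
    obtain ⟨m, -, hm, ms, h1, h2⟩ := key A subset_rfl
    have e : A ∪ insert v (S \ insert v A) = S := by
      rw [Finset.union_insert, ← Finset.insert_union,
        Finset.union_sdiff_of_subset (Finset.insert_subset hv hAS)]
    rw [e] at h1 h2
    exact ⟨ms, h1, fun x hx => (h2 x hx).trans (hm x)⟩
  · obtain ⟨huv, huw, hvw, du, dv, dw⟩ := h
    simp only [degreeIn] at du dv dw
    set S₀ := ((S.erase u).erase w).erase v with hS₀
    have hS₀S : S₀ ⊆ S := fun x hx => by simp [hS₀] at hx; exact hx.2.2.2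
    have e1 : insert v S₀ = (S.erase u).erase w :=
      Finset.insert_erase (by simp [hvw.ne, huv.ne', hv])
    have e2 : insert w (insert v S₀) = S.erase u := by
      rw [e1, Finset.insert_erase (by simp [huw.ne', hw])]
    have e3 : insert u (insert w (insert v S₀)) = S := by
      rw [e2, Finset.insert_erase hu]
    have s2 : insert w (insert v S₀) ⊆ S := e2 ▸ Finset.erase_subset _ _
    have s1 : insert v S₀ ⊆ S := (Finset.subset_insert _ _).trans s2
    have hss : S₀ ⊂ S := Finset.ssubset_iff_subset_ne.2 ⟨hS₀S, fun k => by
      rw [← k] at hv; simp [hS₀] at hv⟩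
    -- The order of return is `v`, `w`, `u`: `v` lacks two of its six neighbours, `w` lacks one of
    -- six, and `u` has five. Both `w` and `u` use `v` as the cheap neighbour.
    have r1 := (ih S₀ hss f g (hf.mono hS₀S) (hg.mono hS₀S)).insert_of_card_le_four (v := v)
      (fun _ => le_rfl) (by simp [hS₀]) (hfilter _ v) (by
        have : S₀.filter (G.Adj v) ⊆ ((S.filter (G.Adj v)).erase u).erase w := by
          intro x hx
          simp [hS₀] at hx ⊢
          tauto
        have := Finset.card_le_card this
        rw [Finset.card_erase_of_mem (by simp [huw.ne', hw, hvw]),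
          Finset.card_erase_of_mem (by simp [hu, huv.symm])] at this
        omega) (hL v) (hf.mono s1) (hg.mono s1)
    have b1 : ∀ x, Function.update (fun _ => 100) v 68 x ≤ 100 := fun x => by
      rcases eq_or_ne x v with rfl | k <;> simp [*]
    have r2 := r1.insert_of_card_le_five (v := w) (w := v) b1 (by rw [e1]; simp) (hfilter _ w) (by
        have : (insert v S₀).filter (G.Adj w) ⊆ (S.filter (G.Adj w)).erase u := by
          rw [e1]
          intro x hx
          simp at hx ⊢
          tauto
        have := Finset.card_le_card this
        rw [Finset.card_erase_of_mem (by simp [hu, huw.symm])] at this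
        omega) (by simp [hvw.symm]) (by simp) (hL w) (hf.mono s2) (hg.mono s2)
    have b2 : ∀ x, Function.update (Function.update (fun _ => 100) v 68) w 95 x ≤ 100 := fun x => by
      rcases eq_or_ne x w with rfl | k
      · simp
      · rw [Function.update_of_ne k]
        exact b1 x
    have r3 := r2.insert_of_card_le_five (v := u) (w := v) b2 (by rw [e2]; simp) (hfilter _ u)
      ((Finset.card_le_card (Finset.filter_subset_filter _ s2)).trans du.le)
      (by simp [huv]) (by simp [hvw.ne]) (hL u) (by rwa [e3]) (by rwa [e3])
    rw [e3] at r3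
    obtain ⟨ms, h1, h2⟩ := r3
    refine ⟨ms, h1, fun x hx => (h2 x hx).trans ?_⟩
    rcases eq_or_ne x u with rfl | k
    · simp
    · rw [Function.update_of_ne k]
      exact b2 x

theorem sum_moveCount [Fintype V] [DecidableEq V] (ms : List (V × α)) :
    ∑ x, moveCount ms x = ms.length := by
  rw [← length_filter_eq_sum_moveCount]
  simp

theorem RecolourSeq.exists_walk [Fintype V] [DecidableEq V] {f g : V → α} {ms : List (V × α)}
    (h : RecolourSeq G L Finset.univ f ms g) (c c' : ListColouring G L) (hc : ⇑c.1 = f)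
    (hc' : ⇑c'.1 = g) : ∃ w : (recolouringGraph G L).Walk c c', w.length ≤ ms.length ∧
      ∀ v, timesRecoloured w v ≤ moveCount ms v := by
  induction h generalizing c with
  | nil h1 h2 =>
    obtain rfl : c = c' := Subtype.ext (DFunLike.ext _ _ fun x => by
      rw [hc, hc', h2 x (Finset.mem_univ x)])
    exact ⟨.nil, le_rfl, fun v => by simp [timesRecoloured]⟩
  | @cons f g x a ms h1 hx h2 ih =>
    have h3 := h2.isColouringOn
    let c₁ : ListColouring G L := ⟨Coloring.mk (Function.update f x a) fun {y z} hyz =>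
      h3.2 y (Finset.mem_univ y) z (Finset.mem_univ z) hyz, fun y => h3.1 y (Finset.mem_univ y)⟩
    have hc₁ : ⇑c₁.1 = Function.update f x a := rfl
    obtain ⟨w, hw, hwc⟩ := ih c₁ hc₁ hc'
    -- A move to the present colour is not an edge of the recolouring graph and is skipped, hence
    -- only inequalities for length and counts.
    by_cases hxa : f x = a
    · obtain rfl : c = c₁ := Subtype.ext (DFunLike.ext _ _ fun y => by
        rw [hc, hc₁, ← hxa, Function.update_eq_self])
      exact ⟨w, hw.trans (Nat.le_succ _), fun v => (hwc v).trans (by simp [moveCount_cons])⟩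
    · have hne : ∀ y, c.1 y ≠ c₁.1 y ↔ x = y := by
        intro y
        rw [hc, hc₁]
        rcases eq_or_ne y x with rfl | k
        · simpa using hxa
        · simp [k, k.symm]
      have hadj : (recolouringGraph G L).Adj c c₁ :=
        ⟨x, (hne x).2 rfl, fun y hy => ((hne y).1 hy).symm⟩
      refine ⟨.cons hadj w, Nat.succ_le_succ hw, fun v => ?_⟩
      have := hwc v
      simp only [timesRecoloured, Walk.darts_cons, List.countP_cons, moveCount_cons] at this ⊢
      simp only [hne, decide_eq_true_eq]
      omega

end Recolouring

theorem mainTheorem3 {V α : Type*} [Fintype V] (G : SimpleGraph V)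
    (hG : Recolouring.IsPlanar G) (L : V → Set α) (hL : ∀ v, 11 ≤ (L v).encard) :
    (Recolouring.recolouringGraph G L).ediam ≤ 100 * (Fintype.card V : ℕ∞) ∧
    ∀ c c' : Recolouring.ListColouring G L,
      ∃ w : (Recolouring.recolouringGraph G L).Walk c c',
        ∀ v, Recolouring.timesRecoloured w v ≤ 100 := by
  classical
  have key : ∀ c c' : Recolouring.ListColouring G L,
      ∃ w : (Recolouring.recolouringGraph G L).Walk c c',
        w.length ≤ 100 * Fintype.card V ∧ ∀ v, Recolouring.timesRecoloured w v ≤ 100 := by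
    intro c c'
    have hcol : ∀ c : Recolouring.ListColouring G L,
        Recolouring.IsColouringOn G L Finset.univ c.1 := fun c =>
      ⟨fun x _ => c.2 x, fun x _ y _ hxy => c.1.valid hxy⟩
    obtain ⟨ms, h1, h2⟩ := Recolouring.recolourableWithin_hundred hG hL Finset.univ c.1 c'.1
      (hcol c) (hcol c')
    obtain ⟨w, hw, hwc⟩ := h1.exists_walk c c' rfl rfl
    refine ⟨w, hw.trans ?_, fun v => (hwc v).trans (h2 v (Finset.mem_univ v))⟩
    rw [← Recolouring.sum_moveCount, mul_comm, ← Finset.card_univ, ← smul_eq_mul]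
    exact Finset.sum_le_card_nsmul _ _ _ h2
  refine ⟨SimpleGraph.ediam_le_of_edist_le fun c c' => ?_, fun c c' => ?_⟩
  · obtain ⟨w, hw, -⟩ := key c c'
    exact (SimpleGraph.edist_le w).trans (by exact_mod_cast hw)
  · obtain ⟨w, -, hw⟩ := key c c'
    exact ⟨w, hw⟩
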